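/- An *isometry* of a metric space is a distance-preserving bijection of the space onto itself. A metric space *indexed* by a set $I$ is a metric space $A$ together with a surjection $f_A\colon I\to A$. Two metric spaces $A,B$ indexed by the same set $I$ are *$\varepsilon$-isometric* if $|d_A(f_A(p),f_A(q))-d_B(f_B(p),f_B(q))|\le\varepsilon$ for all $p,q\in I$. **Theorem.** Let $g_1,\dots,g_m$ be a finite family of isometries of a metric space $X$. Then for every $\varepsilon>0$ and every finite collection $x_1,\dots,x_n$ of elements of $X$ there exist a finite metric space $\widetilde X$, elements $\tilde x_1,\dots,\tilde x_n$ of $\widetilde X$, and isometries $\tilde g_1,\dots,\tilde g_m$ of $\widetilde X$ such that the metric subspaces $\{g_j\cdot x_i : 1\le i\le n,\ 1\le j\le m\}$ of $X$ and $\{\tilde g_j\cdot \tilde x_i : 1\le i\le n,\ 1\le j\le m\}$ of $\widetilde X$, indexed in the natural way by $\{1,\dots,m\}\times\{1,\dots,n\}$, are $\varepsilon$-isometric. -/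

import Mathlib

universe u v w

/-- A metric space indexed by a set `I`: a metric space with a surjection from `I` onto it. -/
structure IndexedMetricSpace (I : Type u) where
  /-- The underlying set. -/
  carrier : Type v
  /-- The metric. -/
  [metric : MetricSpace carrier]
  /-- The indexing surjection. -/
  index : I → carrier
  /-- Every point is indexed. -/
  index_surjective : Function.Surjective index

attribute [instance] IndexedMetricSpace.metric

namespace IndexedMetricSpace

/-- Two metric spaces indexed by the same set `I` are `ε`-isometric if the distances between the
points with indices `i` and `j` differ by at most `ε`, for all `i, j`. -/
def EpsIsometric {I : Type u} (ε : ℝ) (A : IndexedMetricSpace.{u, v} I)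
    (B : IndexedMetricSpace.{u, w} I) : Prop :=
  ∀ i j : I, |dist (A.index i) (A.index j) - dist (B.index i) (B.index j)| ≤ ε

/-- The metric subspace `{f i : i ∈ I}` of `X`, indexed by `I` in the natural way. -/
def ofFamily {I : Type u} {X : Type v} [MetricSpace X] (f : I → X) :
    IndexedMetricSpace.{u, v} I where
  carrier := Set.range f
  index := Set.rangeFactorization f
  index_surjective := Set.rangeFactorization_surjective

end IndexedMetricSpace

/-! The free group `F` on the `g j` acts on `X`. Pull the metric back to `F × Fin n` along `(f, i) ↦
f • x i` and add small multiples of the word metric and the discrete metric: distances stay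
left-invariant, nonzero ones are at least `δ`, and long words are expensive. Residual finiteness
gives a finite quotient `P` of `F` whose kernel has no short nontrivial word. On `P × Fin n` take
the infimum over lifts; left translations are isometries. Between the indexed points only one lift
is short, and it nearly realizes the original distance. -/

/-- A finite quotient of a free group of finite rank that is injective near the identity: left
multiplication by a generator is a partial injection of the ball of radius `L`, which extends to a
permutation of that ball. -/
theorem exists_finite_quotient_freeGroup_norm_lt {α : Type} [Finite α] [DecidableEq α] (L : ℕ) :
    ∃ (P : Type) (_ : Group P) (_ : Finite P) (π : FreeGroup α →* P),
      Function.Surjective π ∧ ∀ f, π f = 1 → f ≠ 1 → L < f.norm := by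
  classical
  let B := {f : FreeGroup α // f.norm ≤ L}
  have hB : Finite B := by
    have := (List.finite_length_le (α × Bool) L).to_subtype
    refine Finite.of_injective (β := {l : List (α × Bool) | l.length ≤ L})
      (fun f => ⟨f.1.toWord, f.2⟩) fun f g h => ?_
    exact Subtype.ext (FreeGroup.toWord_injective (congrArg Subtype.val h))
  have hσ : ∀ a : α, ∃ σ : Equiv.Perm B, ∀ u v : B, v.1 = FreeGroup.of a * u.1 → σ u = v := by
    intro a
    let := Fintype.ofFinite B
    let e : {u : B // (FreeGroup.of a * u.1).norm ≤ L} ≃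
        {v : B // ((FreeGroup.of a)⁻¹ * v.1).norm ≤ L} :=
      { toFun := fun u => ⟨⟨FreeGroup.of a * u.1.1, u.2⟩, by simpa using u.1.2⟩
        invFun := fun v => ⟨⟨(FreeGroup.of a)⁻¹ * v.1.1, v.2⟩, by simpa using v.1.2⟩
        left_inv := fun u => by ext; simp
        right_inv := fun v => by ext; simp }
    refine ⟨e.extendSubtype, fun u v h => ?_⟩
    have hu : (FreeGroup.of a * u.1).norm ≤ L := h ▸ v.2
    rw [e.extendSubtype_apply_of_mem u hu]
    exact Subtype.ext h.symm
  choose σ hσ using hσ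
  let φ : FreeGroup α →* Equiv.Perm B := FreeGroup.lift σ
  let o : B := ⟨1, by simp⟩
  -- Acting on the identity, a word of length at most `L` runs through its suffixes, all in the
  -- ball, so its permutation recovers it.
  have key : ∀ w : List (α × Bool), w.length ≤ L →
      (φ (FreeGroup.mk w) o : FreeGroup α) = FreeGroup.mk w := by
    intro w
    induction w with
    | nil => intro _; exact congrArg (fun s : Equiv.Perm B => (s o).1) (map_one φ)
    | cons c w ih =>
      intro hw
      obtain ⟨a, b⟩ := c
      have hw' : w.length ≤ L := (Nat.le_succ _).trans hw
      let u : B := ⟨FreeGroup.mk w, FreeGroup.norm_mk_le.trans hw'⟩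
      let v : B := ⟨FreeGroup.mk ((a, b) :: w), FreeGroup.norm_mk_le.trans hw⟩
      have hmk : FreeGroup.mk ((a, b) :: w) = FreeGroup.mk [(a, b)] * FreeGroup.mk w := by
        rw [FreeGroup.mul_mk]; rfl
      have hu : φ (FreeGroup.mk w) o = u := Subtype.ext (ih hw')
      rw [hmk, map_mul, Equiv.Perm.mul_apply, hu, ← hmk]
      suffices φ (FreeGroup.mk [(a, b)]) u = v from congrArg Subtype.val this
      have hφ : φ (.of a) = σ a := FreeGroup.lift_apply_of
      cases b with
      | true =>
        change φ (.of a) u = v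
        rw [hφ]
        exact hσ a _ _ hmk
      | false =>
        change φ (.of a)⁻¹ u = v
        rw [map_inv, hφ, Equiv.Perm.inv_eq_iff_eq]
        exact (hσ a v u (eq_inv_mul_iff_mul_eq.1 hmk).symm).symm
  refine ⟨FreeGroup α ⧸ φ.ker, inferInstance,
    Finite.of_equiv _ (QuotientGroup.quotientKerEquivRange φ).symm.toEquiv,
    QuotientGroup.mk' φ.ker, QuotientGroup.mk'_surjective _, fun f hf hf1 => ?_⟩
  by_contra! hL
  have hker : φ f = 1 := (QuotientGroup.eq_one_iff f).1 hf
  have := key f.toWord hL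
  rw [FreeGroup.mk_toWord, hker] at this
  exact hf1 this.symm

/-- A left-invariant metric on `F × ι`, given by the distance `w i f k` from `(1, i)` to `(f, k)`,
all of whose nonzero values are at least `δ`. -/
structure InvariantWeight (F ι : Type*) [Group F] (δ : ℝ) where
  /-- The distance from `(1, i)` to `(f, k)`. -/
  w : ι → F → ι → ℝ
  self : ∀ i, w i 1 i = 0
  symm : ∀ i f k, w k f⁻¹ i = w i f k
  triangle : ∀ i f j f' k, w i (f * f') k ≤ w i f j + w j f' k
  separated : ∀ i f k, (f = 1 → i ≠ k) → δ ≤ w i f k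

namespace InvariantWeight

variable {F P ι : Type*} [Group F] [Group P] {δ : ℝ}

theorem nonneg (W : InvariantWeight F ι δ) (i : ι) (f : F) (k : ι) : 0 ≤ W.w i f k := by
  have h := W.triangle i f k f⁻¹ i
  rw [mul_inv_cancel, W.self, W.symm] at h
  linarith

/-- The distance between two points of `P × ι` induced by an invariant metric on `F × ι` along a
homomorphism `F →* P`. -/
noncomputable def quotientDist (W : InvariantWeight F ι δ) (π : F →* P) (p q : P × ι) : ℝ :=
  ⨅ f : {f : F // p.1 * π f = q.1}, W.w p.2 f q.2

theorem quotientDist_le (W : InvariantWeight F ι δ) (π : F →* P) {p q : P × ι} {f : F}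
    (hf : p.1 * π f = q.1) : W.quotientDist π p q ≤ W.w p.2 f q.2 :=
  ciInf_le (f := fun f : {f : F // p.1 * π f = q.1} => W.w p.2 f q.2)
    ⟨0, by rintro _ ⟨f, rfl⟩; exact W.nonneg _ _ _⟩ ⟨f, hf⟩

theorem le_quotientDist (W : InvariantWeight F ι δ) {π : F →* P} (hπ : Function.Surjective π)
    {p q : P × ι} {c : ℝ} (h : ∀ f, p.1 * π f = q.1 → c ≤ W.w p.2 f q.2) :
    c ≤ W.quotientDist π p q := by
  obtain ⟨f, hf⟩ := hπ (p.1⁻¹ * q.1)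
  have : Nonempty {f : F // p.1 * π f = q.1} := ⟨⟨f, by rw [hf, mul_inv_cancel_left]⟩⟩
  exact le_ciInf fun f => h f.1 f.2

theorem quotientDist_self (W : InvariantWeight F ι δ) {π : F →* P} (hπ : Function.Surjective π)
    (p : P × ι) : W.quotientDist π p p = 0 :=
  le_antisymm ((W.quotientDist_le π (f := 1) (by simp)).trans_eq (W.self _))
    (W.le_quotientDist hπ fun _ _ => W.nonneg _ _ _)

theorem quotientDist_comm_le (W : InvariantWeight F ι δ) {π : F →* P}
    (hπ : Function.Surjective π) (p q : P × ι) :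
    W.quotientDist π p q ≤ W.quotientDist π q p :=
  W.le_quotientDist hπ fun f hf =>
    (W.quotientDist_le π (f := f⁻¹) (by rw [← hf, map_inv, mul_inv_cancel_right])).trans_eq
      (W.symm _ _ _)

theorem quotientDist_triangle (W : InvariantWeight F ι δ) {π : F →* P}
    (hπ : Function.Surjective π) (p q r : P × ι) :
    W.quotientDist π p r ≤ W.quotientDist π p q + W.quotientDist π q r := by
  rw [← sub_le_iff_le_add']
  refine W.le_quotientDist hπ fun f hf => ?_
  rw [sub_le_comm]
  refine W.le_quotientDist hπ fun f' hf' => ?_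
  rw [sub_le_iff_le_add', add_comm]
  exact (W.quotientDist_le π (f := f' * f) (by rw [map_mul, ← mul_assoc, hf', hf])).trans
    (W.triangle _ _ _ _ _)

/-- The quotient metric on `P × ι`. -/
noncomputable abbrev quotientMetric (W : InvariantWeight F ι δ) (hδ : 0 < δ) {π : F →* P}
    (hπ : Function.Surjective π) : MetricSpace (P × ι) where
  dist := W.quotientDist π
  dist_self := W.quotientDist_self hπ
  dist_comm p q := le_antisymm (W.quotientDist_comm_le hπ p q) (W.quotientDist_comm_le hπ q p)
  dist_triangle := W.quotientDist_triangle hπ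
  eq_of_dist_eq_zero {p q} h := by
    by_contra hne
    -- Positivity alone could be lost in the infimum; the uniform bound `δ` survives.
    have : δ ≤ W.quotientDist π p q := W.le_quotientDist hπ fun f hf =>
      W.separated _ _ _ fun h1 h2 => hne (Prod.ext (by simpa [h1] using hf) h2)
    exact absurd (this.trans_eq h) (not_le.2 hδ)

/-- Both infima run over the same lifts of `p.1⁻¹ * q.1`. -/
theorem quotientDist_mul_left (W : InvariantWeight F ι δ) (π : F →* P) (c : P) (p q : P × ι) :
    W.quotientDist π (c * p.1, p.2) (c * q.1, q.2) = W.quotientDist π p q := by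
  exact (Equiv.subtypeEquivRight fun f => by
    simp only [mul_assoc, mul_right_inj]).iInf_congr fun _ => rfl

/-- The invariant metric on `F × ι`, for `F` a free group acting on a metric space `X` by
isometries, obtained by adding `δ` times the word metric and `δ` times the discrete metric to the
pullback of the metric of `X` along `(f, i) ↦ f • x i`. -/
noncomputable def ofAction {α ι X : Type*} [DecidableEq α] [DecidableEq ι] [MetricSpace X]
    (ρ : FreeGroup α →* (X ≃ᵢ X)) (x : ι → X) (hδ : 0 ≤ δ) :
    InvariantWeight (FreeGroup α) ι δ where
  w i f k := dist (x i) (ρ f (x k)) + δ * f.norm + δ * (if i = k then 0 else 1)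
  self i := by simp
  symm i f k := by
    have h : dist (x k) (ρ f⁻¹ (x i)) = dist (x i) (ρ f (x k)) := by
      rw [← (ρ f).dist_eq (x k), map_inv, IsometryEquiv.apply_inv_self, dist_comm]
    rw [h, FreeGroup.norm_inv_eq]
    simp only [eq_comm]
  triangle i f j f' k := by
    have h1 : dist (x i) (ρ (f * f') (x k)) ≤
        dist (x i) (ρ f (x j)) + dist (x j) (ρ f' (x k)) := by
      rw [← (ρ f).dist_eq (x j), map_mul, IsometryEquiv.mul_apply]
      exact dist_triangle _ _ _
    have h2 : δ * ((f * f').norm : ℝ) ≤ δ * f.norm + δ * f'.norm := by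
      rw [← mul_add]
      exact mul_le_mul_of_nonneg_left (by exact_mod_cast FreeGroup.norm_mul_le f f') hδ
    have h3 : δ * (if i = k then 0 else 1 : ℝ) ≤
        δ * (if i = j then 0 else 1) + δ * (if j = k then 0 else 1) := by
      rw [← mul_add]
      refine mul_le_mul_of_nonneg_left ?_ hδ
      split_ifs <;> first | (subst_vars; contradiction) | norm_num
    linarith
  separated i f k h := by
    have hd := dist_nonneg (x := x i) (y := ρ f (x k))
    by_cases hf : f = 1
    · simp only [h hf, if_false]
      have := mul_nonneg hδ (Nat.cast_nonneg (α := ℝ) f.norm)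
      linarith
    · have h1 : (1 : ℝ) ≤ f.norm := by
        exact_mod_cast Nat.one_le_iff_ne_zero.2 (mt FreeGroup.norm_eq_zero.1 hf)
      have h2 := mul_le_mul_of_nonneg_left h1 hδ
      have h3 : 0 ≤ δ * (if i = k then 0 else 1 : ℝ) := by split_ifs <;> simp [hδ]
      linarith

end InvariantWeight

theorem theorem3p2 {X : Type u} [MetricSpace X] (m n : ℕ) (g : Fin m → (X ≃ᵢ X))
    (ε : ℝ) (hε : 0 < ε) (x : Fin n → X) :
    ∃ (Y : Type) (_ : MetricSpace Y) (_ : Finite Y) (y : Fin n → Y) (h : Fin m → (Y ≃ᵢ Y)),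
      IndexedMetricSpace.EpsIsometric ε
        (IndexedMetricSpace.ofFamily fun p : Fin m × Fin n => g p.1 (x p.2))
        (IndexedMetricSpace.ofFamily fun p : Fin m × Fin n => h p.1 (y p.2)) := by
  obtain ⟨D, hD⟩ : ∃ D : ℝ, ∀ p q : Fin m × Fin n,
      dist (g p.1 (x p.2)) (g q.1 (x q.2)) ≤ D := by
    obtain ⟨D, hD⟩ := (Set.finite_range fun r : (Fin m × Fin n) × (Fin m × Fin n) =>
      dist (g r.1.1 (x r.1.2)) (g r.2.1 (x r.2.2))).bddAbove
    exact ⟨D, fun p q => hD ⟨(p, q), rfl⟩⟩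
  -- The short lift `f₀` has length at most 2, and the discrete term adds at most one more `δ`.
  let δ : ℝ := ε / 3
  have hδ : 0 < δ := by positivity
  obtain ⟨K, hK⟩ := exists_nat_gt (D / δ)
  have hKD : D ≤ δ * K := by rw [div_lt_iff₀ hδ] at hK; linarith
  obtain ⟨P, _, _, π, hπ, hker⟩ := exists_finite_quotient_freeGroup_norm_lt (α := Fin m) (K + 2)
  let ρ : FreeGroup (Fin m) →* (X ≃ᵢ X) := FreeGroup.lift g
  let W : InvariantWeight (FreeGroup (Fin m)) (Fin n) δ := InvariantWeight.ofAction ρ x hδ.le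
  let : MetricSpace (P × Fin n) := W.quotientMetric hδ hπ
  refine ⟨P × Fin n, inferInstance, inferInstance, fun i => (1, i), fun j =>
    { toEquiv := (Equiv.mulLeft (π (.of j))).prodCongr (Equiv.refl _)
      isometry_toFun := Isometry.of_dist_eq (W.quotientDist_mul_left π (π (.of j))) },
    fun a b => ?_⟩
  obtain ⟨j, i⟩ := a
  obtain ⟨k, l⟩ := b
  change |dist (g j (x i)) (g k (x l)) -
    W.quotientDist π (π (.of j) * 1, i) (π (.of k) * 1, l)| ≤ ε
  let f₀ : FreeGroup (Fin m) := (.of j)⁻¹ * .of k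
  have hf₀ : f₀.norm ≤ 2 := by
    refine (FreeGroup.norm_mul_le _ _).trans ?_
    rw [FreeGroup.norm_inv_eq, FreeGroup.norm_of, FreeGroup.norm_of]
  have hd : dist (x i) (ρ f₀ (x l)) = dist (g j (x i)) (g k (x l)) := by
    have : ρ f₀ = (g j)⁻¹ * g k := by simp [ρ, f₀]
    rw [this, ← (g j).dist_eq (x i), IsometryEquiv.mul_apply, IsometryEquiv.apply_inv_self]
  have hupper : W.quotientDist π (π (.of j) * 1, i) (π (.of k) * 1, l) ≤
      dist (g j (x i)) (g k (x l)) + ε := by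
    refine (W.quotientDist_le π (f := f₀) (by simp [f₀])).trans ?_
    change dist (x i) (ρ f₀ (x l)) + δ * f₀.norm + δ * (if i = l then 0 else 1) ≤ _
    have h1 : δ * (f₀.norm : ℝ) ≤ δ * 2 :=
      mul_le_mul_of_nonneg_left (by exact_mod_cast hf₀) hδ.le
    have h2 : δ * (if i = l then 0 else 1 : ℝ) ≤ δ := by split_ifs <;> simp [hδ.le]
    have h3 : δ * 3 = ε := by simp [δ]
    linarith
  have hlower : dist (g j (x i)) (g k (x l)) ≤
      W.quotientDist π (π (.of j) * 1, i) (π (.of k) * 1, l) := by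
    refine W.le_quotientDist hπ fun f hf => ?_
    change _ ≤ dist (x i) (ρ f (x l)) + δ * f.norm + δ * (if i = l then 0 else 1)
    have h2 : 0 ≤ δ * (if i = l then 0 else 1 : ℝ) := by split_ifs <;> simp [hδ.le]
    by_cases hff : f = f₀
    · have := mul_nonneg hδ.le (Nat.cast_nonneg (α := ℝ) f.norm)
      rw [hff] at this ⊢
      linarith
    -- Two lifts differ by a kernel element, of length over `K + 2`, and `f₀` uses at most 2 of it;
    -- then `δ * K` already exceeds the diameter bound `D`.
    · have hlong : K ≤ f.norm := by
        have h3 := hker (f * f₀⁻¹) (by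
          have : π f = π f₀ := by simpa [f₀, eq_inv_mul_iff_mul_eq] using hf
          rw [map_mul, map_inv, this, mul_inv_cancel]) (by rwa [Ne, mul_inv_eq_one])
        have h4 := FreeGroup.norm_mul_le f f₀⁻¹
        rw [FreeGroup.norm_inv_eq] at h4
        omega
      have h5 : δ * (K : ℝ) ≤ δ * f.norm :=
        mul_le_mul_of_nonneg_left (by exact_mod_cast hlong) hδ.le
      have h6 := hD (j, i) (k, l)
      have h7 := dist_nonneg (x := x i) (y := ρ f (x l))
      linarith
  rw [abs_le]
  constructor <;> linarith
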